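/- For a nonzero polynomial $P\in\mathbb{Z}[x]$ let $C(P)$ be the number of complex zeros $z$ of $P$ with $|z|\neq 1$, counted with multiplicity, divided by $\deg P$. For integers $A,B\ge 1$ put $\varphi_A(x)=\frac{x^A-1}{x-1}=1+x+\cdots+x^{A-1}$ and $$P_{A,B}(x,y)=x^{\max(A-B,0)}\left(\varphi_A(x)+\varphi_B(x)\,y+x^{B-A}\varphi_A(x)\,y^2\right).$$ For every integer $m>1$ the limit $$LC(P_{m,1})=\lim_{n\to\infty}C\big(P_{m,1}(x,x^n)\big)$$ exists, and it is also equal to $\lim_{n\to\infty}C(H_{2n+2m-2})$, where $H_{2n+2l}(x)=x^{n+l}\Big(\sum_{j=0}^{l}\big(x^{n+j}+x^{-(n+j)}\big)+1\Big)$. Every accumulation point $A\in\mathbb{R}$ of the sequence $(LC(P_{m,1}))_{m>1}$ (that is, every $A$ such that each neighbourhood of $A$ contains $LC(P_{m,1})$ for infinitely many $m$) satisfies $$\frac{2}{\pi^2}\le A\le\frac{2}{3\pi}.$$ -/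

import Mathlib

open Polynomial Filter Topology

/-- The ratio `C(P)` between the number of nonunimodular complex zeros of `P`
(zeros of modulus different from `1`, counted with multiplicity) and the degree of `P`. -/
noncomputable def nonunimodularRatio (P : ℤ[X]) : ℝ :=
  (((P.aroots ℂ).filter (fun z => ‖z‖ ≠ 1)).card : ℝ) / (P.natDegree : ℝ)

/-- The limit ratio `LC` of a sequence of polynomials: the limit of `C(P n)` as `n → ∞`
(meaningful when this limit exists). -/
noncomputable def limitRatio (P : ℕ → ℤ[X]) : ℝ :=
  limUnder atTop (fun n => nonunimodularRatio (P n))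

/-- `φ_A(x) = (x ^ A - 1) / (x - 1) = 1 + x + ⋯ + x ^ (A - 1)`. -/
noncomputable def phiPoly (A : ℕ) : ℤ[X] :=
  ∑ i ∈ Finset.range A, X ^ i

theorem phiPoly_mul (A : ℕ) : phiPoly A * (X - 1) = X ^ A - 1 :=
  geom_sum_mul X A

/-- The bivariate polynomial
`P_{A,B}(x,y) = x ^ max(A-B,0) (φ_A(x) + φ_B(x) y + x ^ (B-A) φ_A(x) y ^ 2)`,
as a polynomial in `y` with coefficients in `ℤ[x]`. The subtraction of natural numbers is
truncated, so `A - B` in the code is `max(A-B,0)`; and the exponent of `x` in the last term is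
`max(A-B,0) + (B-A) = max(B-A,0)`, which is `B - A` in the code. -/
noncomputable def bivP (A B : ℕ) : Polynomial ℤ[X] :=
  C (X ^ (A - B) * phiPoly A) + C (X ^ (A - B) * phiPoly B) * X + C (X ^ (B - A) * phiPoly A) * X ^ 2

/-- The one-variable polynomial `F(x, x ^ n)` of a bivariate polynomial `F(x,y)`. -/
noncomputable def substPow (F : Polynomial ℤ[X]) (n : ℕ) : ℤ[X] :=
  F.eval (X ^ n)

/-- The limit ratio of a bivariate polynomial `F(x,y)`: the limit of `C(F(x, x ^ n))`
as `n → ∞`. -/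
noncomputable def bivLimitRatio (F : Polynomial ℤ[X]) : ℝ :=
  limitRatio (substPow F)

/-- The monic reciprocal polynomial of degree `2n+2l`
`H_{2n+2l}(x) = x ^ (n+l) (∑_{j=0}^{l} (x ^ (n+j) + x ^ (-(n+j))) + 1)`, multiplied out. -/
noncomputable def polyH (l n : ℕ) : ℤ[X] :=
  ∑ j ∈ Finset.range (l + 1), (X ^ (2 * n + l + j) + X ^ (l - j)) + X ^ (n + l)

/-- The polynomial `H_{2n+2l}` in the form with negative powers of `x`. -/
theorem polyH_toLaurent (l n : ℕ) :
    toLaurent (polyH l n) = LaurentPolynomial.T ((n : ℤ) + l) *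
      (∑ j ∈ Finset.range (l + 1),
        (LaurentPolynomial.T ((n : ℤ) + j) + LaurentPolynomial.T (-((n : ℤ) + j))) + 1) := by
  simp only [polyH, map_add, map_sum, toLaurent_X_pow, mul_add, mul_one, Finset.mul_sum,
    ← LaurentPolynomial.T_add]
  congr 1
  · refine Finset.sum_congr rfl fun j hj => ?_
    have hj' : j ≤ l := by simpa [Nat.lt_succ_iff] using hj
    congr 2
    · push_cast; ring
    · push_cast [hj']; ring

/-- `P_{l+1,1}(x, x ^ (n+l)) = x ^ l H_{2n+2l}(x)`. -/
theorem substPow_bivP (l n : ℕ) :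
    substPow (bivP (l + 1) 1) (n + l) = X ^ l * polyH l n := by
  have h : ∑ j ∈ Finset.range (l + 1), (X : ℤ[X]) ^ (l - j) = phiPoly (l + 1) := by
    simpa [phiPoly] using Finset.sum_range_reflect (fun i => (X : ℤ[X]) ^ i) (l + 1)
  have h2 : ∑ j ∈ Finset.range (l + 1), (X : ℤ[X]) ^ (2 * n + l + j)
      = X ^ (2 * n + l) * phiPoly (l + 1) := by
    simp [phiPoly, pow_add, Finset.mul_sum]
  have h1 : phiPoly 1 = 1 := by simp [phiPoly]
  simp only [substPow, bivP, polyH, Finset.sum_add_distrib, h, h2, h1, eval_add, eval_mul,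
    eval_C, eval_X, eval_pow]
  simp
  ring

/-!
Put `m = l + 1` and `x = exp (2iu)` with `0 < u < π`. On the unit circle
`x ^ (-(n + l)) H_{2n+2l}(x) = 1 + 2 cos (Mu) D_l(u)`, where `M = 2n + l` and
`D_l(u) = sin (mu) / sin u` (`circleTwist_polyH`, `dirichletSum_mul_sin`). Hence there is no
unimodular zero where `|D_l| < 1/2`, while for large `n` the rapid oscillation of `cos (Mu)` makes
one zero per half-period where `|D_l| > 1/2`. As the degree of `H_{2n+2l}` is `2n + 2l`, the
nonunimodular zeros have limiting proportion `|{u ∈ (0, π) : |D_l(u)| < 1/2}| / π`.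

The lower bound for the number of unimodular zeros is a count of sign changes
(`le_card_unimodularAngles`). For the upper bound the zeros have to be counted with multiplicity.
In a cell `|Mu - kπ| ≤ π / 2` the product `cos (Mu) D_l(u)` stays below `-1/4` between two zeros, so
that the second derivative is positive there; by Rolle's theorem with multiplicities the cell
contains at most two zeros (`card_angles_cell_le_two`), and at most every second cell
contains any (`card_unimodularAngles_le`). Both bounds have an error term governed by the measure of
`{||D_l| - 1/2| ≤ O(1/M)}`, which tends to `0` because the level set is finite
(`tendsto_volume_bandSet`). The polynomial `P_{m,1}(x, x ^ (n + l))` is `x ^ l H_{2n+2l}(x)`, and the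
fixed number `l` of additional zeros at the origin does not affect the limit.

For the accumulation points, `|D_l(u)| < 1/2` means `|sin (mu)| < (sin u) / 2`. Since
`|sin y| ≤ |y|` always, and `|sin y| < s / 2` with `|y| ≤ π / 2` forces `|y| < (π / 6) s`, this set
lies between unions of intervals of radius about `κ sin (kπ / m) / m` around the points `kπ / m`, with
`κ = 1/2` and `κ = π / 6` (`sineSum_div_le_volume_lowSet`, `volume_lowSet_le`). As
`∑ sin (kπ / m) = cot (π / 2m)` is asymptotic to `2m / π`, the two unions have measures tending to
`2 / π` and `2 / 3`.
-/

/-! ### The Dirichlet-type sum -/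

/-- The Dirichlet-type sum `D_l(u) = ∑_{j ≤ l} cos ((2j - l) u)`, equal to
`sin ((l + 1) u) / sin u` where the latter makes sense. -/
noncomputable def dirichletSum (l : ℕ) (u : ℝ) : ℝ :=
  ∑ j ∈ Finset.range (l + 1), Real.cos ((2 * j - l) * u)

/-- The derivative of `dirichletSum l`. -/
noncomputable def dirichletSumDeriv (l : ℕ) (u : ℝ) : ℝ :=
  ∑ j ∈ Finset.range (l + 1), -((2 * j - l) * Real.sin ((2 * j - l) * u))

/-- The second derivative of `dirichletSum l`. -/
noncomputable def dirichletSumDeriv2 (l : ℕ) (u : ℝ) : ℝ :=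
  ∑ j ∈ Finset.range (l + 1), -((2 * j - l) ^ 2 * Real.cos ((2 * j - l) * u))

theorem hasDerivAt_dirichletSum (l : ℕ) (u : ℝ) :
    HasDerivAt (dirichletSum l) (dirichletSumDeriv l u) u := by
  unfold dirichletSum dirichletSumDeriv
  refine HasDerivAt.fun_sum fun j _ => ?_
  have h := ((hasDerivAt_id u).const_mul (2 * (j : ℝ) - l)).cos
  exact h.congr_deriv (by simp; ring)

theorem hasDerivAt_dirichletSumDeriv (l : ℕ) (u : ℝ) :
    HasDerivAt (dirichletSumDeriv l) (dirichletSumDeriv2 l u) u := by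
  unfold dirichletSumDeriv dirichletSumDeriv2
  refine HasDerivAt.fun_sum fun j _ => ?_
  have h := (((hasDerivAt_id u).const_mul (2 * (j : ℝ) - l)).sin.const_mul (2 * (j : ℝ) - l)).neg
  exact h.congr_deriv (by simp; ring)

theorem continuous_dirichletSum (l : ℕ) : Continuous (dirichletSum l) :=
  continuous_iff_continuousAt.2 fun u => (hasDerivAt_dirichletSum l u).continuousAt

theorem dirichletSum_mul_sin (l : ℕ) (u : ℝ) :
    dirichletSum l u * Real.sin u = Real.sin ((l + 1) * u) := by
  have h : ∀ j : ℕ, 2 * (Real.cos ((2 * j - l) * u) * Real.sin u)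
      = Real.sin ((2 * ((j + 1 : ℕ) : ℝ) - l - 1) * u) - Real.sin ((2 * (j : ℝ) - l - 1) * u) := by
    intro j
    have e1 : (2 * ((j + 1 : ℕ) : ℝ) - l - 1) * u = (2 * j - l) * u + u := by push_cast; ring
    have e2 : (2 * (j : ℝ) - l - 1) * u = (2 * j - l) * u - u := by ring
    rw [e1, e2, Real.sin_add, Real.sin_sub]; ring
  have h2 : 2 * (dirichletSum l u * Real.sin u) = 2 * Real.sin ((l + 1) * u) := by
    rw [dirichletSum, Finset.sum_mul, Finset.mul_sum, Finset.sum_congr rfl fun j _ => h j,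
      Finset.sum_range_sub (fun j : ℕ => Real.sin ((2 * (j : ℝ) - l - 1) * u))]
    have e1 : (2 * ((l + 1 : ℕ) : ℝ) - l - 1) * u = (l + 1) * u := by push_cast; ring
    have e2 : (2 * ((0 : ℕ) : ℝ) - l - 1) * u = -((l + 1) * u) := by push_cast; ring
    rw [e1, e2, Real.sin_neg]; ring
  linarith

theorem abs_two_mul_sub_le {l j : ℕ} (hj : j ∈ Finset.range (l + 1)) :
    |2 * (j : ℝ) - l| ≤ l := by
  have : (j : ℝ) ≤ l := by exact_mod_cast Nat.lt_succ_iff.1 (Finset.mem_range.1 hj)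
  have h0 : (0 : ℝ) ≤ j := j.cast_nonneg
  rw [abs_le]; constructor <;> linarith

/-- A common bound for the first two derivatives of `dirichletSum l`. -/
theorem exists_dirichletSum_bound (l : ℕ) : ∃ K : ℝ, 1 ≤ K ∧
    (∀ u, |dirichletSumDeriv l u| ≤ K) ∧ ∀ u, |dirichletSumDeriv2 l u| ≤ K := by
  have hl : (0 : ℝ) ≤ l := l.cast_nonneg
  refine ⟨(l + 1) ^ 3, one_le_pow₀ (by linarith), fun u => ?_, fun u => ?_⟩
  · refine (Finset.abs_sum_le_sum_abs _ _).trans ((Finset.sum_le_card_nsmul _ _ (l : ℝ)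
      fun j hj => ?_).trans ?_)
    · rw [abs_neg, abs_mul]
      simpa using mul_le_mul (abs_two_mul_sub_le hj) (Real.abs_sin_le_one _) (abs_nonneg _) hl
    · simp; nlinarith [mul_nonneg hl hl, mul_nonneg hl (mul_nonneg hl hl)]
  · refine (Finset.abs_sum_le_sum_abs _ _).trans ((Finset.sum_le_card_nsmul _ _ ((l : ℝ) ^ 2)
      fun j hj => ?_).trans ?_)
    · rw [abs_neg, abs_mul, abs_pow]
      simpa using mul_le_mul (pow_le_pow_left₀ (abs_nonneg _) (abs_two_mul_sub_le hj) 2)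
        (Real.abs_cos_le_one _) (abs_nonneg _) (by positivity)
    · simp; nlinarith [mul_nonneg hl hl, mul_nonneg hl (mul_nonneg hl hl)]

theorem abs_dirichletSum_sub_le {l : ℕ} {K : ℝ} (hK : ∀ u, |dirichletSumDeriv l u| ≤ K) (u v : ℝ) :
    |dirichletSum l u - dirichletSum l v| ≤ K * |u - v| := by
  simpa using Convex.norm_image_sub_le_of_norm_hasDerivWithin_le (s := Set.univ)
    (fun x _ => (hasDerivAt_dirichletSum l x).hasDerivWithinAt) (fun x _ => hK x) convex_univ
    (Set.mem_univ v) (Set.mem_univ u)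

/-! ### The polynomial on the unit circle -/

/-- The restriction of `x ^ (-c) P(x)` to the unit circle, parametrized by `x = exp (2iu)`. -/
noncomputable def circleTwist (c : ℕ) (P : ℂ[X]) (u : ℝ) : ℂ :=
  Complex.exp (-(2 * c * u * Complex.I)) * P.eval (Complex.exp (2 * u * Complex.I))

/-- The differential operator on polynomials which corresponds to `d/du` under `circleTwist c`. -/
noncomputable def circleTwistDeriv (c : ℕ) (P : ℂ[X]) : ℂ[X] :=
  C (2 * Complex.I) * (X * derivative P - C (c : ℂ) * P)

theorem hasDerivAt_circleTwist (c : ℕ) (P : ℂ[X]) (u : ℝ) :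
    HasDerivAt (circleTwist c P) (circleTwist c (circleTwistDeriv c P) u) u := by
  have hu : HasDerivAt (fun u : ℝ => (u : ℂ)) 1 u := Complex.ofRealCLM.hasDerivAt
  have h1 : HasDerivAt (fun u : ℝ => Complex.exp (-(2 * c * u * Complex.I)))
      (Complex.exp (-(2 * c * u * Complex.I)) * (-(2 * c * 1 * Complex.I))) u :=
    ((hu.const_mul (2 * (c : ℂ))).mul_const Complex.I).neg.cexp
  have h2 : HasDerivAt (fun u : ℝ => Complex.exp (2 * u * Complex.I))
      (Complex.exp (2 * u * Complex.I) * (2 * 1 * Complex.I)) u :=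
    ((hu.const_mul (2 : ℂ)).mul_const Complex.I).cexp
  have h3 := (P.hasDerivAt (Complex.exp (2 * u * Complex.I))).comp u h2
  refine (h1.mul h3).congr_deriv ?_
  simp only [circleTwist, circleTwistDeriv, eval_mul, eval_sub, eval_C, eval_X,
    Function.comp_apply]
  ring

theorem pow_dvd_circleTwistDeriv {c k : ℕ} {P Q : ℂ[X]} (h : Q ^ (k + 1) ∣ P) :
    Q ^ k ∣ circleTwistDeriv c P := by
  have h1 : Q ^ k ∣ derivative P := by simpa using pow_sub_one_dvd_derivative_of_pow_dvd h
  have h2 : Q ^ k ∣ P := (pow_dvd_pow Q (Nat.le_succ k)).trans h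
  exact ((h1.mul_left _).sub (h2.mul_left _)).mul_left _

theorem circleTwist_eq_zero_iff {c : ℕ} {P : ℂ[X]} {u : ℝ} :
    circleTwist c P u = 0 ↔ P.IsRoot (Complex.exp (2 * u * Complex.I)) := by
  simp [circleTwist, Complex.exp_ne_zero]

/-- The real form `1 + 2 cos ((2n + l) u) D_l(u)` of `x ^ (-(n + l)) H_{2n+2l}(x)` at
`x = exp (2iu)`. -/
noncomputable def circleForm (l n : ℕ) (u : ℝ) : ℝ :=
  2 * (Real.cos ((2 * n + l : ℕ) * u) * dirichletSum l u) + 1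

theorem circleForm_eq_sum (l n : ℕ) (u : ℝ) :
    circleForm l n u = ∑ j ∈ Finset.range (l + 1), 2 * Real.cos (2 * (n + j) * u) + 1 := by
  -- the reflection `j ↦ l - j` changes the sign of each term
  have hs : ∑ j ∈ Finset.range (l + 1), Real.sin ((2 * (j : ℝ) - l) * u) = 0 := by
    have h := Finset.sum_range_reflect (fun j : ℕ => Real.sin ((2 * (j : ℝ) - l) * u)) (l + 1)
    have h' : ∑ j ∈ Finset.range (l + 1), Real.sin ((2 * ((l + 1 - 1 - j : ℕ) : ℝ) - l) * u)
        = -∑ j ∈ Finset.range (l + 1), Real.sin ((2 * (j : ℝ) - l) * u) := by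
      rw [← Finset.sum_neg_distrib]
      refine Finset.sum_congr rfl fun j hj => ?_
      rw [← Real.sin_neg, Nat.add_sub_cancel, Nat.cast_sub (Nat.lt_succ_iff.1 (Finset.mem_range.1 hj))]
      congr 1; ring
    linarith
  have h : ∀ j : ℕ, 2 * Real.cos (2 * (n + j) * u)
      = 2 * (Real.cos ((2 * n + l : ℕ) * u) * Real.cos ((2 * (j : ℝ) - l) * u))
        - 2 * Real.sin ((2 * n + l : ℕ) * u) * Real.sin ((2 * (j : ℝ) - l) * u) := by
    intro j
    have e : 2 * ((n : ℝ) + j) * u = (2 * n + l : ℕ) * u + (2 * (j : ℝ) - l) * u := by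
      push_cast; ring
    rw [e, Real.cos_add]; ring
  rw [Finset.sum_congr rfl fun j _ => h j, Finset.sum_sub_distrib, ← Finset.mul_sum, ← Finset.mul_sum,
    ← Finset.mul_sum, hs, circleForm, dirichletSum]
  ring

theorem circleTwist_polyH (l n : ℕ) (u : ℝ) :
    circleTwist (n + l) ((polyH l n).map (algebraMap ℤ ℂ)) u = (circleForm l n u : ℂ) := by
  have h : ∀ j ∈ Finset.range (l + 1), Complex.exp (-(2 * (n + l : ℕ) * u * Complex.I)) *
      (Complex.exp (2 * u * Complex.I) ^ (2 * n + l + j) + Complex.exp (2 * u * Complex.I) ^ (l - j))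
      = 2 * Complex.cos (2 * (n + j) * u) := by
    intro j hj
    rw [Complex.two_cos, mul_add, ← Complex.exp_nat_mul, ← Complex.exp_nat_mul, ← Complex.exp_add,
      ← Complex.exp_add, Nat.cast_sub (Nat.lt_succ_iff.1 (Finset.mem_range.1 hj))]
    congr 2 <;> push_cast <;> ring
  rw [circleForm_eq_sum]
  simp only [circleTwist, polyH, Polynomial.map_add, Polynomial.map_sum, Polynomial.map_pow, map_X,
    eval_add, eval_finsetSum, eval_pow, eval_X, mul_add, Finset.mul_sum]
  simp only [← mul_add, Complex.ofReal_add, Complex.ofReal_sum]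
  rw [Finset.sum_congr rfl h]
  congr 1
  · simp
  · rw [← Complex.exp_nat_mul, ← Complex.exp_add]
    push_cast
    rw [Complex.exp_eq_one_iff]
    exact ⟨0, by push_cast; ring⟩

/-- The derivative of `circleForm`. -/
noncomputable def circleFormDeriv (l n : ℕ) (u : ℝ) : ℝ :=
  2 * (-((2 * n + l : ℕ) * Real.sin ((2 * n + l : ℕ) * u)) * dirichletSum l u
    + Real.cos ((2 * n + l : ℕ) * u) * dirichletSumDeriv l u)

/-- The second derivative of `circleForm`. -/
noncomputable def circleFormDeriv2 (l n : ℕ) (u : ℝ) : ℝ :=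
  2 * ((2 * n + l : ℕ) ^ 2 * -(Real.cos ((2 * n + l : ℕ) * u) * dirichletSum l u)
    - 2 * ((2 * n + l : ℕ) * Real.sin ((2 * n + l : ℕ) * u) * dirichletSumDeriv l u)
    + Real.cos ((2 * n + l : ℕ) * u) * dirichletSumDeriv2 l u)

theorem hasDerivAt_circleForm (l n : ℕ) (u : ℝ) :
    HasDerivAt (circleForm l n) (circleFormDeriv l n u) u := by
  have h1 := ((hasDerivAt_id u).const_mul ((2 * n + l : ℕ) : ℝ)).cos
  have h := ((h1.mul (hasDerivAt_dirichletSum l u)).const_mul 2).add_const 1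
  refine h.congr_deriv ?_
  simp only [circleFormDeriv, id]; ring

theorem hasDerivAt_circleFormDeriv (l n : ℕ) (u : ℝ) :
    HasDerivAt (circleFormDeriv l n) (circleFormDeriv2 l n u) u := by
  have h1 := ((hasDerivAt_id u).const_mul ((2 * n + l : ℕ) : ℝ)).cos
  have h2 := (((hasDerivAt_id u).const_mul ((2 * n + l : ℕ) : ℝ)).sin.const_mul
    ((2 * n + l : ℕ) : ℝ)).neg
  have h := ((h2.mul (hasDerivAt_dirichletSum l u)).add
    (h1.mul (hasDerivAt_dirichletSumDeriv l u))).const_mul 2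
  refine h.congr_deriv ?_
  simp only [circleFormDeriv2, id, Pi.neg_apply]; ring

theorem continuous_circleForm (l n : ℕ) : Continuous (circleForm l n) :=
  continuous_iff_continuousAt.2 fun u => (hasDerivAt_circleForm l n u).continuousAt

theorem circleTwist_deriv_polyH (l n : ℕ) (u : ℝ) :
    circleTwist (n + l) (circleTwistDeriv (n + l) ((polyH l n).map (algebraMap ℤ ℂ))) u
      = (circleFormDeriv l n u : ℂ) := by
  have h := hasDerivAt_circleTwist (n + l) ((polyH l n).map (algebraMap ℤ ℂ)) u
  rw [funext (circleTwist_polyH l n)] at h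
  exact h.unique (hasDerivAt_circleForm l n u).ofReal_comp

theorem circleTwist_deriv_deriv_polyH (l n : ℕ) (u : ℝ) :
    circleTwist (n + l) (circleTwistDeriv (n + l)
      (circleTwistDeriv (n + l) ((polyH l n).map (algebraMap ℤ ℂ)))) u
      = (circleFormDeriv2 l n u : ℂ) := by
  have h := hasDerivAt_circleTwist (n + l)
    (circleTwistDeriv (n + l) ((polyH l n).map (algebraMap ℤ ℂ))) u
  rw [funext (circleTwist_deriv_polyH l n)] at h
  exact h.unique (hasDerivAt_circleFormDeriv l n u).ofReal_comp

theorem circleForm_eq_zero_iff {l n : ℕ} {u : ℝ} : circleForm l n u = 0 ↔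
    ((polyH l n).map (algebraMap ℤ ℂ)).IsRoot (Complex.exp (2 * u * Complex.I)) := by
  rw [← circleTwist_eq_zero_iff (c := n + l), circleTwist_polyH, Complex.ofReal_eq_zero]

/-- A double root of `H` on the unit circle is a double zero of `circleForm`. -/
theorem circleFormDeriv_eq_zero {l n : ℕ} {u : ℝ}
    (h : (X - C (Complex.exp (2 * u * Complex.I))) ^ 2 ∣
    (polyH l n).map (algebraMap ℤ ℂ)) : circleFormDeriv l n u = 0 := by
  rw [← Complex.ofReal_eq_zero, ← circleTwist_deriv_polyH, circleTwist_eq_zero_iff,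
    ← dvd_iff_isRoot]
  simpa using pow_dvd_circleTwistDeriv (k := 1) h

/-- A triple root of `H` on the unit circle is a triple zero of `circleForm`. -/
theorem circleFormDeriv2_eq_zero {l n : ℕ} {u : ℝ}
    (h : (X - C (Complex.exp (2 * u * Complex.I))) ^ 3 ∣
    (polyH l n).map (algebraMap ℤ ℂ)) : circleFormDeriv2 l n u = 0 := by
  rw [← Complex.ofReal_eq_zero, ← circleTwist_deriv_deriv_polyH, circleTwist_eq_zero_iff,
    ← dvd_iff_isRoot]
  simpa using pow_dvd_circleTwistDeriv (c := n + l) (k := 1) (pow_dvd_circleTwistDeriv (k := 2) h)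

/-! ### The degree -/

theorem polyH_eq (l n : ℕ) :
    polyH l n = X ^ (2 * n + l) * phiPoly (l + 1) + X ^ (n + l) + phiPoly (l + 1) := by
  have h : ∑ j ∈ Finset.range (l + 1), (X : ℤ[X]) ^ (l - j) = phiPoly (l + 1) := by
    simpa [phiPoly] using Finset.sum_range_reflect (fun i => (X : ℤ[X]) ^ i) (l + 1)
  simp only [polyH, Finset.sum_add_distrib, h, pow_add, Finset.mul_sum, phiPoly]
  ring

theorem natDegree_polyH {l n : ℕ} (hn : 0 < n) : (polyH l n).natDegree = 2 * n + 2 * l := by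
  have hφ : (phiPoly (l + 1)).Monic := Polynomial.Monic.geom_sum' monic_X (by simp) (by simp)
  have hd : (phiPoly (l + 1)).natDegree = l := by
    have h1 : (X - 1 : ℤ[X]).Monic := monic_X_sub_C 1
    have h2 : (X - 1 : ℤ[X]).natDegree = 1 := natDegree_X_sub_C 1
    have h3 : (X ^ (l + 1) - 1 : ℤ[X]).natDegree = l + 1 := natDegree_X_pow_sub_C (r := (1 : ℤ))
    have h := congrArg natDegree (phiPoly_mul (l + 1))
    rw [hφ.natDegree_mul h1, h2, h3] at h
    omega
  have h1 : (X ^ (2 * n + l) * phiPoly (l + 1)).natDegree = 2 * n + 2 * l := by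
    rw [(monic_X_pow _).natDegree_mul hφ, natDegree_X_pow, hd]; ring
  have h2 : (X ^ (n + l) : ℤ[X]).natDegree = n + l := natDegree_X_pow _
  have h3 : (X ^ (2 * n + l) * phiPoly (l + 1) + X ^ (n + l)).natDegree = 2 * n + 2 * l := by
    rw [natDegree_add_eq_left_of_natDegree_lt (by omega), h1]
  rw [polyH_eq, natDegree_add_eq_left_of_natDegree_lt (by omega), h3]

theorem polyH_ne_zero {l n : ℕ} (hn : 0 < n) : polyH l n ≠ 0 := by
  rintro h
  have := natDegree_polyH (l := l) hn
  rw [h, natDegree_zero] at this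
  omega

/-! ### Unimodular zeros and their angles -/

/-- The point `exp (2iu)` of the unit circle. As `u` runs through `(0, π)` it runs through the
circle without `1`. -/
noncomputable def circlePoint (u : ℝ) : ℂ := Complex.exp (2 * u * Complex.I)

/-- The inverse of `circlePoint` on the unit circle, with values in `(0, π]`; the argument of `-z`
puts the branch cut at `z = 1`, which is not a zero of `H`. -/
noncomputable def circleAngle (z : ℂ) : ℝ := (Complex.arg (-z) + Real.pi) / 2

theorem norm_circlePoint (u : ℝ) : ‖circlePoint u‖ = 1 := by
  rw [circlePoint, show (2 * (u : ℂ) * Complex.I) = ((2 * u : ℝ) : ℂ) * Complex.I by push_cast; ring,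
    Complex.norm_exp_ofReal_mul_I]

theorem circlePoint_circleAngle {z : ℂ} (hz : ‖z‖ = 1) : circlePoint (circleAngle z) = z := by
  have h := Complex.norm_mul_exp_arg_mul_I (-z)
  rw [norm_neg, hz, Complex.ofReal_one, one_mul] at h
  rw [circlePoint, circleAngle, show (2 * (((Complex.arg (-z) + Real.pi) / 2 : ℝ) : ℂ) * Complex.I)
    = Complex.arg (-z) * Complex.I + Real.pi * Complex.I by push_cast; ring, Complex.exp_add, h,
    Complex.exp_pi_mul_I]
  ring

theorem circlePoint_injOn : Set.InjOn circlePoint (Set.Ioo 0 Real.pi) := by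
  rintro u hu v hv h
  obtain ⟨k, hk⟩ := Complex.exp_eq_exp_iff_exists_int.1 h
  have h1 : u = v + k * Real.pi := by
    have h2 : ((u : ℂ) - (v + k * Real.pi)) * (2 * Complex.I) = 0 := by linear_combination hk
    have h3 := (mul_eq_zero.1 h2).resolve_right (by simp)
    exact_mod_cast sub_eq_zero.1 h3
  have hpi := Real.pi_pos
  have hk0 : k = 0 := by
    have h3 : (k : ℝ) < 1 := by
      by_contra! h
      nlinarith [hu.1, hu.2, hv.1, hv.2]
    have h4 : (-1 : ℝ) < k := by
      by_contra! h
      nlinarith [hu.1, hu.2, hv.1, hv.2]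
    have h5 : k < 1 := by exact_mod_cast h3
    have h6 : -1 < k := by exact_mod_cast h4
    omega
  simpa [hk0] using h1

/-- The angles `u` of the unimodular zeros `exp (2iu)` of `H`, with multiplicity. -/
noncomputable def unimodularAngles (l n : ℕ) : Multiset ℝ :=
  (((polyH l n).aroots ℂ).filter (fun z => ‖z‖ = 1)).map circleAngle

theorem map_circlePoint_unimodularAngles (l n : ℕ) : (unimodularAngles l n).map circlePoint
    = ((polyH l n).aroots ℂ).filter (fun z => ‖z‖ = 1) := by
  rw [unimodularAngles, Multiset.map_map]
  conv_rhs => rw [← Multiset.map_id (Multiset.filter _ _)]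
  exact Multiset.map_congr rfl fun z hz => circlePoint_circleAngle (Multiset.mem_filter.1 hz).2

theorem unimodularAngles_mem {l n : ℕ} {u : ℝ} (hu : u ∈ unimodularAngles l n) :
    u ∈ Set.Ioo 0 Real.pi ∧ circleForm l n u = 0 := by
  obtain ⟨z, hz, rfl⟩ := Multiset.mem_map.1 hu
  obtain ⟨hz, hz1⟩ := Multiset.mem_filter.1 hz
  have hr : circleForm l n (circleAngle z) = 0 := by
    rw [circleForm_eq_zero_iff]
    have h := (mem_roots'.1 hz).2
    rw [← circlePoint_circleAngle hz1] at h
    exact h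
  refine ⟨⟨?_, ?_⟩, hr⟩
  · have := Complex.neg_pi_lt_arg (-z)
    rw [circleAngle]; linarith
  · have h1 := Complex.arg_le_pi (-z)
    -- the angle `π` is the point `1`, where the form has the value `2l + 3`
    refine lt_of_le_of_ne (by rw [circleAngle]; linarith) fun h => ?_
    rw [h, circleForm_eq_sum, Finset.sum_congr rfl (g := fun _ => (2 : ℝ))] at hr
    · simp at hr
      linarith [(l.cast_nonneg : (0 : ℝ) ≤ l)]
    · intro j _
      rw [show 2 * ((n : ℝ) + j) * Real.pi = (n + j : ℕ) * (2 * Real.pi) by push_cast; ring,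
        Real.cos_nat_mul_two_pi, mul_one]

/-! ### At most two zeros in a cell -/

/-- Three angles of unimodular zeros, counted with multiplicity, have a zero of the second
derivative of `circleForm` in their convex hull: Rolle's theorem with multiplicities. -/
theorem exists_circleFormDeriv2_eq_zero {l n : ℕ} (hn : 0 < n) {a b c : ℝ}
    (hab : a ≤ b) (hbc : b ≤ c)
    (h : ({circlePoint a, circlePoint b, circlePoint c} : Multiset ℂ) ≤ (polyH l n).aroots ℂ) :
    ∃ v ∈ Set.Icc a c, circleFormDeriv2 l n v = 0 := by
  have h0 : (polyH l n).map (algebraMap ℤ ℂ) ≠ 0 :=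
    (Polynomial.map_ne_zero_iff (algebraMap ℤ ℂ).injective_int).2 (polyH_ne_zero hn)
  have hd := (Multiset.prod_X_sub_C_dvd_iff_le_roots h0 _).2 h
  simp only [Multiset.insert_eq_cons, Multiset.map_cons, Multiset.map_singleton,
    Multiset.prod_cons, Multiset.prod_singleton] at hd
  have ha : circleForm l n a = 0 :=
    circleForm_eq_zero_iff.2 (dvd_iff_isRoot.1 ((dvd_mul_right _ _).trans hd))
  have hb : circleForm l n b = 0 :=
    circleForm_eq_zero_iff.2 (dvd_iff_isRoot.1 (((dvd_mul_right _ _).mul_left _).trans hd))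
  have hc : circleForm l n c = 0 :=
    circleForm_eq_zero_iff.2 (dvd_iff_isRoot.1 (((dvd_mul_left _ _).mul_left _).trans hd))
  have hcont := (continuous_circleForm l n).continuousOn (s := Set.univ)
  -- if `a = b`, the derivative vanishes at the double zero; otherwise strictly in between
  have hv1 : ∃ v ∈ Set.Icc a b, circleFormDeriv l n v = 0 ∧ (v = b → a = b) := by
    rcases hab.eq_or_lt with rfl | hlt
    · refine ⟨a, ⟨le_rfl, le_rfl⟩, circleFormDeriv_eq_zero ?_, fun _ => rfl⟩
      exact dvd_trans ⟨X - C (circlePoint c), by simp only [circlePoint]; ring⟩ hd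
    · obtain ⟨v, hv, h⟩ := exists_hasDerivAt_eq_zero hlt (hcont.mono (Set.subset_univ _))
        (ha.trans hb.symm) (fun x _ => hasDerivAt_circleForm l n x)
      exact ⟨v, ⟨hv.1.le, hv.2.le⟩, h, fun e => absurd e hv.2.ne⟩
  have hv2 : ∃ v ∈ Set.Icc b c, circleFormDeriv l n v = 0 ∧ (v = b → b = c) := by
    rcases hbc.eq_or_lt with rfl | hlt
    · refine ⟨b, ⟨le_rfl, le_rfl⟩, circleFormDeriv_eq_zero ?_, fun _ => rfl⟩
      exact dvd_trans ⟨X - C (circlePoint a), by simp only [circlePoint]; ring⟩ hd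
    · obtain ⟨v, hv, h⟩ := exists_hasDerivAt_eq_zero hlt (hcont.mono (Set.subset_univ _))
        (hb.trans hc.symm) (fun x _ => hasDerivAt_circleForm l n x)
      exact ⟨v, ⟨hv.1.le, hv.2.le⟩, h, fun e => absurd e hv.1.ne'⟩
  obtain ⟨v, hv, hv', hve⟩ := hv1
  obtain ⟨w, hw, hw', hwe⟩ := hv2
  -- the two zeros of the derivative coincide only if `a = b = c` is a triple zero
  rcases (hv.2.trans hw.1).eq_or_lt with hvw | hvw
  · have e1 : v = b := le_antisymm hv.2 (hvw ▸ hw.1)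
    have e2 := hve e1
    have e3 := hwe (hvw ▸ e1)
    subst e2 e3
    refine ⟨a, ⟨le_rfl, le_rfl⟩, circleFormDeriv2_eq_zero ?_⟩
    exact dvd_trans ⟨1, by simp only [circlePoint]; ring⟩ hd
  · obtain ⟨x, hx, h⟩ := exists_hasDerivAt_eq_zero hvw
      (fun x _ => (hasDerivAt_circleFormDeriv l n x).continuousAt.continuousWithinAt)
      (hv'.trans hw'.symm) (fun x _ => hasDerivAt_circleFormDeriv l n x)
    exact ⟨x, ⟨hv.1.trans hx.1.le, hx.2.le.trans hw.2⟩, h⟩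

/-- Where `cos (Mu) D_l(u) ≤ -1/4`, the form is strictly convex as soon as `M = 2n + l` is large:
the term of order `M ^ 2` dominates. -/
theorem circleFormDeriv2_pos {l n : ℕ} {K u : ℝ} (hK1 : 1 ≤ K)
    (hK : ∀ u, |dirichletSumDeriv l u| ≤ K)
    (hK2 : ∀ u, |dirichletSumDeriv2 l u| ≤ K) (hM : 16 * K ≤ (2 * n + l : ℕ))
    (hu : Real.cos ((2 * n + l : ℕ) * u) * dirichletSum l u ≤ -(1 / 4)) :
    0 < circleFormDeriv2 l n u := by
  rw [circleFormDeriv2]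
  set M : ℝ := ((2 * n + l : ℕ) : ℝ)
  have h1 : |Real.sin (M * u) * dirichletSumDeriv l u| ≤ K := by
    rw [abs_mul]
    simpa using mul_le_mul (Real.abs_sin_le_one _) (hK u) (abs_nonneg _) zero_le_one
  have h2 : |Real.cos (M * u) * dirichletSumDeriv2 l u| ≤ K := by
    rw [abs_mul]
    simpa using mul_le_mul (Real.abs_cos_le_one _) (hK2 u) (abs_nonneg _) zero_le_one
  have h3 : M * (Real.sin (M * u) * dirichletSumDeriv l u) ≤ M * K :=
    mul_le_mul_of_nonneg_left (abs_le.1 h1).2 (by linarith)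
  have h4 : M ^ 2 * (1 / 4) ≤ M ^ 2 * -(Real.cos (M * u) * dirichletSum l u) :=
    mul_le_mul_of_nonneg_left (by linarith) (sq_nonneg _)
  have h5 := (abs_le.1 h2).1
  have h6 : 16 * K * M ≤ M * M := mul_le_mul_of_nonneg_right hM (by linarith)
  have h7 : K * 16 ≤ K * M := mul_le_mul_of_nonneg_left (by linarith) (by linarith)
  nlinarith

theorem cos_eq_neg_one_pow_mul_cos_sub (x : ℝ) (k : ℤ) :
    Real.cos x = (-1) ^ k * Real.cos (x - k * Real.pi) := by
  rw [Real.cos_sub_int_mul_pi, ← mul_assoc, ← mul_zpow]; simp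

theorem abs_neg_one_zpow_eq_one (k : ℤ) : |(-1 : ℝ) ^ k| = 1 := by
  rw [abs_zpow]; simp

theorem neg_one_zpow_mul_dirichletSum_le {l n : ℕ} {u : ℝ} {k : ℤ} (h0 : circleForm l n u = 0)
    (hu : |(2 * n + l : ℕ) * u - k * Real.pi| ≤ Real.pi / 2) :
    (-1) ^ k * dirichletSum l u ≤ -(1 / 2) := by
  rw [circleForm, cos_eq_neg_one_pow_mul_cos_sub _ k] at h0
  have h1 : 0 ≤ Real.cos ((2 * n + l : ℕ) * u - k * Real.pi) :=
    Real.cos_nonneg_of_mem_Icc (abs_le.1 hu)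
  have h2 := Real.cos_le_one ((2 * n + l : ℕ) * u - k * Real.pi)
  have h3 : Real.cos ((2 * n + l : ℕ) * u - k * Real.pi) * ((-1) ^ k * dirichletSum l u)
      = -(1 / 2) := by linarith
  by_contra! h4
  have h5 : Real.cos ((2 * n + l : ℕ) * u - k * Real.pi) ≠ 0 := fun h => by
    rw [h] at h3; norm_num at h3
  linarith [mul_pos (lt_of_le_of_ne h1 h5.symm) (sub_pos.2 h4)]

/-- In the cell `|Mu - kπ| ≤ π / 2`, where `M = 2n + l`, the cosine `cos (Mu)` has constant sign.
For large `M` such a cell contains at most two unimodular zeros, counted with multiplicity. -/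
theorem card_angles_cell_le_two {l n : ℕ} (hn : 0 < n) {K : ℝ} (hK1 : 1 ≤ K)
    (hK : ∀ u, |dirichletSumDeriv l u| ≤ K) (hK2 : ∀ u, |dirichletSumDeriv2 l u| ≤ K)
    (hM : 16 * K ≤ (2 * n + l : ℕ)) (k : ℤ) {T : Multiset ℝ} (hT : T ≤ unimodularAngles l n)
    (hk : ∀ u ∈ T, |(2 * n + l : ℕ) * u - k * Real.pi| ≤ Real.pi / 2) : T.card ≤ 2 := by
  by_contra! hcard
  obtain ⟨a, b, c, hab, hbc, hle⟩ : ∃ a b c, a ≤ b ∧ b ≤ c ∧ ({a, b, c} : Multiset ℝ) ≤ T := by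
    have hs := T.pairwise_sort (· ≤ ·)
    have he := T.sort_eq (· ≤ ·)
    have hl := T.length_sort (r := (· ≤ ·))
    match hL : T.sort (· ≤ ·), hl with
    | [], hl | [_], hl | [_, _], hl => simp at hl; omega
    | a :: b :: c :: L, _ =>
      rw [hL] at hs he
      simp only [List.pairwise_cons, List.mem_cons] at hs
      refine ⟨a, b, c, hs.1 _ (by simp), hs.2.1 _ (by simp), ?_⟩
      rw [← he]
      change ((([a, b, c] : List ℝ) : Multiset ℝ)) ≤ _
      exact Multiset.coe_le.2 (List.Sublist.subperm (by simp))
  have hpos := Real.pi_pos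
  have hM0 : (0 : ℝ) < (2 * n + l : ℕ) := by linarith
  have hmem : ∀ u ∈ ({a, b, c} : Multiset ℝ), circleForm l n u = 0 ∧
      |(2 * n + l : ℕ) * u - k * Real.pi| ≤ Real.pi / 2 := fun u hu =>
    ⟨(unimodularAngles_mem (Multiset.mem_of_le (hle.trans hT) hu)).2,
      hk u (Multiset.mem_of_le hle hu)⟩
  obtain ⟨ha0, hak⟩ := hmem a (by simp)
  obtain ⟨hc0, hck⟩ := hmem c (by simp)
  have hroots := Multiset.map_le_map (f := circlePoint) (hle.trans hT)
  rw [map_circlePoint_unimodularAngles] at hroots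
  obtain ⟨v, hv, hv0⟩ := exists_circleFormDeriv2_eq_zero (l := l) hn hab hbc
    (by simpa using hroots.trans (Multiset.filter_le _ _))
  refine (circleFormDeriv2_pos hK1 hK hK2 hM ?_).ne' hv0
  set M : ℝ := ((2 * n + l : ℕ) : ℝ)
  have hva : M * a ≤ M * v := mul_le_mul_of_nonneg_left hv.1 hM0.le
  have hvc : M * v ≤ M * c := mul_le_mul_of_nonneg_left hv.2 hM0.le
  -- on the cell the cosine is concave up to sign, hence minimal in modulus at an endpoint
  have hmin := strictConcaveOn_cos_Icc.concaveOn.min_le_of_mem_Icc (abs_le.1 hak) (abs_le.1 hck)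
    (z := M * v - k * Real.pi) ⟨by linarith, by linarith⟩
  have key : ∀ w, circleForm l n w = 0 → |M * w - k * Real.pi| ≤ Real.pi / 2 →
      |M * (v - w)| ≤ Real.pi → Real.cos (M * w - k * Real.pi) ≤ Real.cos (M * v - k * Real.pi) →
      Real.cos (M * v) * dirichletSum l v ≤ -(1 / 4) := by
    intro w hw hwk hvw hcos
    have hD := neg_one_zpow_mul_dirichletSum_le hw hwk
    have hc0 : 0 ≤ Real.cos (M * w - k * Real.pi) := Real.cos_nonneg_of_mem_Icc (abs_le.1 hwk)
    rw [circleForm, cos_eq_neg_one_pow_mul_cos_sub _ k] at hw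
    rw [cos_eq_neg_one_pow_mul_cos_sub _ k]
    have hlip : (-1) ^ k * dirichletSum l v ≤ (-1) ^ k * dirichletSum l w + 1 / 4 := by
      have h1 : |(-1) ^ k * dirichletSum l v - (-1) ^ k * dirichletSum l w| ≤ K * |v - w| := by
        rw [← mul_sub, abs_mul, abs_neg_one_zpow_eq_one, one_mul]
        exact abs_dirichletSum_sub_le hK v w
      have h2 : K * |v - w| ≤ 1 / 4 := by
        rw [abs_mul, abs_of_pos hM0] at hvw
        have h3 : 16 * K * |v - w| ≤ M * |v - w| := mul_le_mul_of_nonneg_right hM (abs_nonneg _)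
        linarith [Real.pi_le_four]
      linarith [(abs_le.1 h1).2]
    have hcle := Real.cos_le_one (M * w - k * Real.pi)
    have h1 : Real.cos (M * v - k * Real.pi) * ((-1) ^ k * dirichletSum l v)
        ≤ Real.cos (M * w - k * Real.pi) * ((-1) ^ k * dirichletSum l v) :=
      mul_le_mul_of_nonpos_right hcos (by linarith)
    have h2 : Real.cos (M * w - k * Real.pi) * ((-1) ^ k * dirichletSum l v)
        ≤ Real.cos (M * w - k * Real.pi) * ((-1) ^ k * dirichletSum l w + 1 / 4) :=
      mul_le_mul_of_nonneg_left hlip hc0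
    change 2 * ((-1) ^ k * Real.cos (M * w - k * Real.pi) * dirichletSum l w) + 1 = 0 at hw
    linarith
  have hak' := abs_le.1 hak
  have hck' := abs_le.1 hck
  rcases min_le_iff.1 hmin with h | h
  · refine key a ha0 hak ?_ h
    rw [abs_le]; constructor <;> linarith
  · refine key c hc0 hck ?_ h
    rw [abs_le]; constructor <;> linarith

section Measure

open MeasureTheory Set

/-! ### The sets where the Dirichlet-type sum is small or critical -/

/-- The part of `(0, π)` where `|D_l| < 1/2`; there is no unimodular zero there. -/
def lowSet (l : ℕ) : Set ℝ := {u | u ∈ Ioo 0 Real.pi ∧ |dirichletSum l u| < 1 / 2}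

/-- The part of `(0, π)` where `|D_l|` is within `ε` of the critical level `1/2`. -/
def bandSet (l : ℕ) (ε : ℝ) : Set ℝ := {u | u ∈ Ioo 0 Real.pi ∧ |(|dirichletSum l u| - 1 / 2)| ≤ ε}

theorem measurableSet_lowSet (l : ℕ) : MeasurableSet (lowSet l) :=
  measurableSet_Ioo.inter
    (isOpen_lt (continuous_dirichletSum l).abs continuous_const).measurableSet

theorem measurableSet_bandSet (l : ℕ) (ε : ℝ) : MeasurableSet (bandSet l ε) :=
  measurableSet_Ioo.inter
    (isClosed_le (((continuous_dirichletSum l).abs.sub continuous_const).abs)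
      continuous_const).measurableSet

theorem volume_ne_top_of_subset_Ioo {s : Set ℝ} {a b : ℝ} (h : s ⊆ Ioo a b) : volume s ≠ ⊤ :=
  ((measure_mono h).trans_lt measure_Ioo_lt_top).ne

theorem volume_real_diff_lowSet (l : ℕ) :
    volume.real (Ioo 0 Real.pi \ lowSet l) = Real.pi - volume.real (lowSet l) := by
  rw [measureReal_sdiff (fun u hu => hu.1) (measurableSet_lowSet l) measure_Ioo_lt_top.ne]
  simp [Real.pi_pos.le]

theorem finite_abs_dirichletSum_eq (l : ℕ) :
    {u | u ∈ Ioo 0 Real.pi ∧ |dirichletSum l u| = 1 / 2}.Finite := by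
  have hl : (0 : ℝ) ≤ l := l.cast_nonneg
  have hne : ∀ c : ℝ, c < 1 → Chebyshev.U ℝ l - C c ≠ 0 := by
    intro c hc h
    have := congrArg (Polynomial.eval 1) h
    simp [Chebyshev.U_eval_one] at this
    linarith
  have hfin : ∀ c : ℝ, c < 1 → {u | u ∈ Ioo 0 Real.pi ∧ dirichletSum l u = c}.Finite := by
    intro c hc
    refine Set.Finite.of_finite_image (f := Real.cos)
      (((Chebyshev.U ℝ l - C c).roots.toFinset.finite_toSet).subset ?_)
      (Real.injOn_cos.mono fun u hu => Ioo_subset_Icc_self hu.1)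
    rintro _ ⟨u, ⟨hu, hD⟩, rfl⟩
    have hs : Real.sin u ≠ 0 := (Real.sin_pos_of_mem_Ioo hu).ne'
    have h1 := Chebyshev.U_real_cos u l
    have h2 := dirichletSum_mul_sin l u
    have h3 : (Chebyshev.U ℝ l).eval (Real.cos u) = c := by
      rw [← hD]
      refine mul_right_cancel₀ hs ?_
      rw [h1, h2]; simp
    simp [hne c hc, h3]
  refine ((hfin (1 / 2) (by norm_num)).union (hfin (-(1 / 2)) (by norm_num))).subset ?_
  rintro u ⟨hu, h⟩
  rcases eq_or_eq_neg_of_abs_eq h with h | h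
  · exact Or.inl ⟨hu, h⟩
  · exact Or.inr ⟨hu, h⟩

theorem tendsto_volume_bandSet (l : ℕ) :
    Tendsto (fun ε => volume.real (bandSet l ε)) (𝓝[>] 0) (𝓝 0) := by
  have h := tendsto_measure_biInter_gt (μ := volume) (s := bandSet l) (a := 0)
    (fun r _ => (measurableSet_bandSet l r).nullMeasurableSet)
    (fun i j _ hij u hu => ⟨hu.1, hu.2.trans hij⟩)
    ⟨1, one_pos, volume_ne_top_of_subset_Ioo fun u hu => hu.1⟩
  have h0 : volume (⋂ r, ⋂ (_ : r > 0), bandSet l r) = 0 := by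
    refine ((finite_abs_dirichletSum_eq l).subset fun u hu => ?_).measure_zero _
    simp only [mem_iInter] at hu
    refine ⟨(hu 1 one_pos).1, ?_⟩
    have : |(|dirichletSum l u| - 1 / 2)| ≤ 0 :=
      le_of_forall_pos_le_add fun ε hε => by simpa using (hu ε hε).2
    linarith [abs_nonpos_iff.1 this]
  rw [h0] at h
  exact (ENNReal.tendsto_toReal ENNReal.zero_ne_top).comp h

/-! ### Counting the unimodular zeros -/

/-- Upper bound for the number of unimodular zeros with multiplicity. Each cell `|Mu - kπ| ≤ π / 2`
contains at most two of them, and only every second cell inside `{|D_l| ≥ 1/2}` contains any,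
because `cos (Mu) D_l(u) < 0` at a zero. -/
theorem card_unimodularAngles_le {l n : ℕ} (hn : 0 < n) {K : ℝ} (hK1 : 1 ≤ K)
    (hK : ∀ u, |dirichletSumDeriv l u| ≤ K) (hK2 : ∀ u, |dirichletSumDeriv2 l u| ≤ K)
    (hM : 16 * K ≤ (2 * n + l : ℕ)) :
    Real.pi * (unimodularAngles l n).card ≤ (2 * n + l : ℕ) * (Real.pi - volume.real (lowSet l)
      + volume.real (bandSet l (2 * Real.pi * K / (2 * n + l : ℕ)))) + 3 * Real.pi := by
  set M : ℝ := ((2 * n + l : ℕ) : ℝ) with hMdef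
  set ε := 2 * Real.pi * K / M with hε
  set V := unimodularAngles l n
  have hpi := Real.pi_pos
  have hM0 : 0 < M := by linarith
  set kk : ℝ → ℤ := fun u => round (M * u / Real.pi)
  have hkk : ∀ u, |M * u - kk u * Real.pi| ≤ Real.pi / 2 := by
    intro u
    have h := abs_sub_round (M * u / Real.pi)
    have e : M * u - kk u * Real.pi = (M * u / Real.pi - round (M * u / Real.pi)) * Real.pi := by
      field_simp; simp only [kk]; ring
    rw [e, abs_mul, abs_of_pos hpi]
    nlinarith
  set ks := (V.map kk).toFinset
  have hcard : V.card ≤ 2 * ks.card := by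
    rw [← Multiset.card_map kk V, ← Multiset.toFinset_sum_count_eq, mul_comm]
    refine Finset.sum_le_card_nsmul _ _ 2 fun b _ => ?_
    rw [Multiset.count_map]
    refine card_angles_cell_le_two hn hK1 hK hK2 hM b (Multiset.filter_le _ _) fun u hu => ?_
    rw [(Multiset.mem_filter.1 hu).2]
    exact hkk u
  -- `J b` is the union of the cells `b` and `b + 1`, of length `2π / M`
  set J : ℤ → Set ℝ := fun b => Ioo ((b - 1 / 2) * (Real.pi / M)) ((b + 3 / 2) * (Real.pi / M))
  have hδ : 0 < Real.pi / M := by positivity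
  have hε2 : ε < 1 / 2 := by
    rw [hε, div_lt_iff₀ hM0]
    nlinarith [Real.pi_lt_four]
  have hJ : ∀ b ∈ ks, ∀ v ∈ J b, (∃ u ∈ Ioo 0 Real.pi, u - Real.pi / M < v ∧
      v < u + 2 * (Real.pi / M)) ∧ (-1) ^ b * dirichletSum l v ≤ -(1 / 2) + ε := by
    intro b hb v hv
    obtain ⟨u, hu, rfl⟩ := Multiset.mem_map.1 (Multiset.mem_toFinset.1 hb)
    obtain ⟨hu1, hu0⟩ := unimodularAngles_mem hu
    have hD := neg_one_zpow_mul_dirichletSum_le hu0 (hkk u)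
    have hk := abs_le.1 (hkk u)
    have eM : M * (Real.pi / M) = Real.pi := by field_simp
    have h1 : u - Real.pi / M < v := by
      refine lt_of_le_of_lt ?_ hv.1
      refine le_of_mul_le_mul_left ?_ hM0
      rw [mul_sub, mul_left_comm, eM]; linarith
    have h2 : v < u + 2 * (Real.pi / M) := by
      refine lt_of_lt_of_le hv.2 ?_
      refine le_of_mul_le_mul_left ?_ hM0
      rw [mul_add, mul_left_comm, mul_left_comm M 2, eM]; linarith
    refine ⟨⟨u, hu1, h1, h2⟩, ?_⟩
    have h3 : |(-1) ^ kk u * dirichletSum l v - (-1) ^ kk u * dirichletSum l u| ≤ K * |v - u| := by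
      rw [← mul_sub, abs_mul, abs_neg_one_zpow_eq_one, one_mul]
      exact abs_dirichletSum_sub_le hK v u
    have h4 : |v - u| ≤ 2 * (Real.pi / M) := by
      rw [abs_le]; constructor <;> linarith
    have h5 : K * |v - u| ≤ ε := by
      rw [hε, show 2 * Real.pi * K / M = K * (2 * (Real.pi / M)) by ring]
      exact mul_le_mul_of_nonneg_left h4 (by linarith)
    linarith [(abs_le.1 h3).2]
  have hdisj : (ks : Set ℤ).PairwiseDisjoint J := by
    have key : ∀ b ∈ ks, ∀ c ∈ ks, b < c → Disjoint (J b) (J c) := by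
      intro b hb c hc hbc
      rw [Set.disjoint_left]
      intro v hvb hvc
      have h1 := (hJ b hb v hvb).2
      have h2 := (hJ c hc v hvc).2
      have h3 : (c : ℝ) - 1 / 2 < b + 3 / 2 := lt_of_mul_lt_mul_right (hvc.1.trans hvb.2) hδ.le
      have h4 : c < b + 2 := by
        have : (c : ℝ) < b + 2 := by linarith
        exact_mod_cast this
      -- overlapping intervals have adjacent indices, which prescribe opposite signs of `D_l`
      have h5 : c = b + 1 := by omega
      rw [h5, zpow_add_one₀ (by norm_num)] at h2
      linarith
    intro b hb c hc hbc
    rcases lt_or_gt_of_ne hbc with h | h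
    · exact key b hb c hc h
    · exact (key c hc b hb h).symm
  have hvol : volume.real (⋃ b ∈ ks, J b) = ks.card * (2 * (Real.pi / M)) := by
    rw [measureReal_biUnion_finset hdisj (fun _ _ => measurableSet_Ioo)
      (fun _ _ => measure_Ioo_lt_top.ne), Finset.sum_congr rfl (g := fun _ => 2 * (Real.pi / M))]
    · simp
    · intro b _
      rw [Real.volume_real_Ioo_of_le (by nlinarith)]; ring
  have hsub : (⋃ b ∈ ks, J b) ⊆ (((Ioo 0 Real.pi \ lowSet l) ∪ bandSet l ε) ∪
      Icc (-(Real.pi / M)) 0) ∪ Icc Real.pi (Real.pi + 2 * (Real.pi / M)) := by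
    intro v hv
    simp only [mem_iUnion] at hv
    obtain ⟨b, hb, hv⟩ := hv
    obtain ⟨⟨u, hu, h1, h2⟩, hD⟩ := hJ b hb v hv
    rcases le_or_gt v 0 with hv0 | hv0
    · exact Or.inl (Or.inr ⟨by linarith [hu.1], hv0⟩)
    rcases le_or_gt Real.pi v with hv1 | hv1
    · exact Or.inr ⟨hv1, by linarith [hu.2]⟩
    refine Or.inl (Or.inl ?_)
    by_cases hlow : |dirichletSum l v| < 1 / 2
    · refine Or.inr ⟨⟨hv0, hv1⟩, ?_⟩
      have h3 : |dirichletSum l v| = |(-1) ^ b * dirichletSum l v| := by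
        rw [abs_mul, abs_neg_one_zpow_eq_one, one_mul]
      have h4 := neg_le_abs ((-1) ^ b * dirichletSum l v)
      rw [abs_le]; constructor <;> linarith
    · exact Or.inl ⟨⟨hv0, hv1⟩, fun h => hlow h.2⟩
  have hle := measureReal_mono (μ := volume) hsub (by
    refine (measure_union_lt_top (measure_union_lt_top (measure_union_lt_top ?_ ?_) ?_) ?_).ne
    · exact (volume_ne_top_of_subset_Ioo sdiff_subset).lt_top
    · exact (volume_ne_top_of_subset_Ioo fun u hu => hu.1).lt_top
    · exact measure_Icc_lt_top
    · exact measure_Icc_lt_top)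
  have hle2 := hle.trans ((measureReal_union_le _ _).trans (add_le_add_left
    ((measureReal_union_le _ _).trans (add_le_add_left (measureReal_union_le _ _) _)) _))
  rw [hvol, volume_real_diff_lowSet, Real.volume_real_Icc_of_le (by linarith),
    Real.volume_real_Icc_of_le (by linarith)] at hle2
  have hcard' : (V.card : ℝ) ≤ 2 * ks.card := by exact_mod_cast hcard
  have h1 : (V.card : ℝ) * (Real.pi / M) ≤ Real.pi - volume.real (lowSet l)
      + volume.real (bandSet l ε) + 3 * (Real.pi / M) := by
    have := mul_le_mul_of_nonneg_right hcard' hδ.le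
    linarith
  have h2 := mul_le_mul_of_nonneg_left h1 hM0.le
  have e1 : M * (V.card * (Real.pi / M)) = Real.pi * V.card := by field_simp
  have e2 : M * (3 * (Real.pi / M)) = 3 * Real.pi := by field_simp
  rw [mul_add M _ (3 * _), e1, e2] at h2
  exact h2

theorem mem_unimodularAngles {l n : ℕ} (hn : 0 < n) {u : ℝ} (hu : u ∈ Ioo 0 Real.pi)
    (h0 : circleForm l n u = 0) : u ∈ unimodularAngles l n := by
  have h1 : circlePoint u ∈ (unimodularAngles l n).map circlePoint := by
    rw [map_circlePoint_unimodularAngles, Multiset.mem_filter]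
    refine ⟨mem_roots'.2 ⟨(Polynomial.map_ne_zero_iff (algebraMap ℤ ℂ).injective_int).2
      (polyH_ne_zero hn), circleForm_eq_zero_iff.1 h0⟩, norm_circlePoint u⟩
  obtain ⟨v, hv, hvu⟩ := Multiset.mem_map.1 h1
  rwa [← circlePoint_injOn (unimodularAngles_mem hv).1 hu hvu]

/-- Between consecutive extrema of `cos (Mu)` inside `{|D_l| > 1/2}` the form changes sign. -/
theorem exists_circleForm_eq_zero {l n : ℕ} {a b : ℝ} (hab : a ≤ b) (k : ℕ)
    (ha : (2 * n + l : ℕ) * a = k * Real.pi) (hb : (2 * n + l : ℕ) * b = (k + 1) * Real.pi)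
    (hD : ∀ u ∈ Icc a b, 1 / 2 < |dirichletSum l u|) :
    ∃ u ∈ Ioo a b, circleForm l n u = 0 := by
  have hca : circleForm l n a = 2 * ((-1) ^ k * dirichletSum l a) + 1 := by
    rw [circleForm, ha, Real.cos_nat_mul_pi]
  have hcb : circleForm l n b = -2 * ((-1) ^ k * dirichletSum l b) + 1 := by
    have : Real.cos ((2 * n + l : ℕ) * b) = -(-1) ^ k := by
      rw [hb, show ((k : ℝ) + 1) * Real.pi = (k + 1 : ℕ) * Real.pi by push_cast; ring,
        Real.cos_nat_mul_pi, pow_succ]; ring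
    rw [circleForm, this]; ring
  set s : ℝ → ℝ := fun u => (-1) ^ k * dirichletSum l u with hs
  have hscont : ContinuousOn s (Icc a b) :=
    (continuous_const.mul (continuous_dirichletSum l)).continuousOn
  have hsD : ∀ u ∈ Icc a b, 1 / 2 < |s u| := by
    intro u hu
    rw [hs]
    simpa [abs_mul] using hD u hu
  have hs0 : ∀ u ∈ Icc a b, s u ≠ 0 := fun u hu h => by
    have := hsD u hu
    rw [h] at this; norm_num at this
  have hcont := (continuous_circleForm l n).continuousOn (s := Icc a b)
  have ha' := hsD a ⟨le_rfl, hab⟩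
  have hb' := hsD b ⟨hab, le_rfl⟩
  rcases le_or_gt (s a) 0 with h | h
  · have h2 : s b < 0 := by
      by_contra! h2
      obtain ⟨u, hu, h3⟩ := intermediate_value_Icc hab hscont ⟨h, h2⟩
      exact hs0 u hu h3
    rw [abs_of_nonpos h] at ha'
    rw [abs_of_neg h2] at hb'
    exact intermediate_value_Ioo hab hcont ⟨by rw [hca]; linarith, by rw [hcb]; linarith⟩
  · have h2 : 0 < s b := by
      by_contra! h2
      obtain ⟨u, hu, h3⟩ := intermediate_value_Icc' hab hscont ⟨h2, h.le⟩
      exact hs0 u hu h3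
    rw [abs_of_pos h] at ha'
    rw [abs_of_pos h2] at hb'
    exact intermediate_value_Ioo' hab hcont ⟨by rw [hcb]; linarith, by rw [hca]; linarith⟩

/-- Lower bound for the number of unimodular zeros, by counting sign changes. -/
theorem le_card_unimodularAngles {l n : ℕ} (hn : 0 < n) {K : ℝ} (hK1 : 1 ≤ K)
    (hK : ∀ u, |dirichletSumDeriv l u| ≤ K) :
    (2 * n + l : ℕ) * (Real.pi - volume.real (lowSet l)
      - volume.real (bandSet l (2 * Real.pi * K / (2 * n + l : ℕ))))
      ≤ Real.pi * (unimodularAngles l n).card := by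
  set M : ℝ := ((2 * n + l : ℕ) : ℝ) with hMdef
  set ε := 2 * Real.pi * K / M with hε
  have hpi := Real.pi_pos
  have hM0 : 0 < M := by rw [hMdef]; exact_mod_cast (by omega : 0 < 2 * n + l)
  set I : ℕ → Set ℝ := fun k => Icc (k * (Real.pi / M)) ((k + 1) * (Real.pi / M))
  have hδ : 0 < Real.pi / M := by positivity
  have eM : M * (Real.pi / M) = Real.pi := by field_simp
  classical
  set ks := (Finset.range (2 * n + l)).filter (fun k => ∀ u ∈ I k, 1 / 2 < |dirichletSum l u|)
  have hex : ∀ k ∈ ks, ∃ u ∈ Ioo (k * (Real.pi / M)) ((k + 1) * (Real.pi / M)),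
      circleForm l n u = 0 := by
    intro k hk
    refine exists_circleForm_eq_zero (by nlinarith) k ?_ ?_ (Finset.mem_filter.1 hk).2
    · rw [← hMdef, mul_left_comm, eM]
    · rw [← hMdef, mul_left_comm, eM]
  choose! z hz hz0 using hex
  have hcard : ks.card ≤ (unimodularAngles l n).card := by
    refine le_trans ?_ (Multiset.toFinset_card_le (unimodularAngles l n))
    refine Finset.card_le_card_of_injOn z (fun k hk => ?_) ?_
    · rw [Finset.mem_coe, Multiset.mem_toFinset]
      refine mem_unimodularAngles hn ⟨lt_of_le_of_lt (by positivity) (hz k hk).1,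
        lt_of_lt_of_le (hz k hk).2 ?_⟩ (hz0 k hk)
      have h1 : (k : ℝ) + 1 ≤ M := by
        rw [hMdef]
        exact_mod_cast Finset.mem_range.1 (Finset.mem_filter.1 hk).1
      calc _ ≤ M * (Real.pi / M) := mul_le_mul_of_nonneg_right h1 hδ.le
        _ = _ := eM
    · have key : ∀ i ∈ ks, ∀ j ∈ ks, i < j → z i < z j := by
        intro i hi j hj hij
        have h1 : (i : ℝ) + 1 ≤ j := by exact_mod_cast hij
        exact (hz i hi).2.trans_le ((mul_le_mul_of_nonneg_right h1 hδ.le).trans (hz j hj).1.le)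
      intro i hi j hj hij
      rcases lt_trichotomy i j with h | h | h
      · exact absurd hij (key i hi j hj h).ne
      · exact h
      · exact absurd hij (key j hj i hi h).ne'
  have hsub : Ioo 0 Real.pi \ lowSet l ⊆ bandSet l ε ∪ ⋃ k ∈ ks, I k := by
    rintro u ⟨hu, hlow⟩
    have h1 : 1 / 2 ≤ |dirichletSum l u| := not_lt.1 fun h => hlow ⟨hu, h⟩
    rcases le_or_gt (|dirichletSum l u|) (1 / 2 + ε) with h2 | h2
    · exact Or.inl ⟨hu, by rw [abs_of_nonneg (by linarith)]; linarith⟩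
    refine Or.inr ?_
    have hu0 : 0 ≤ u / (Real.pi / M) := (div_pos hu.1 hδ).le
    have hf1 := Nat.floor_le hu0
    have hf2 := Nat.lt_floor_add_one (u / (Real.pi / M))
    rw [le_div_iff₀ hδ] at hf1
    rw [div_lt_iff₀ hδ] at hf2
    set k := ⌊u / (Real.pi / M)⌋₊
    simp only [mem_iUnion]
    refine ⟨k, Finset.mem_filter.2 ⟨Finset.mem_range.2 ?_, fun v hv => ?_⟩, hf1, hf2.le⟩
    · have : (k : ℝ) < M := by
        by_contra! h
        have := mul_le_mul_of_nonneg_right h hδ.le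
        linarith [hu.2]
      rw [hMdef] at this
      exact_mod_cast this
    · have h3 : |v - u| ≤ Real.pi / M := by
        have h4 := hv.1
        have h5 := hv.2
        rw [abs_le]; constructor <;> linarith
      have h4 := abs_dirichletSum_sub_le hK u v
      rw [abs_sub_comm u v] at h4
      have h5 : K * |v - u| ≤ ε := by
        have h6 : K * |v - u| ≤ K * (Real.pi / M) := mul_le_mul_of_nonneg_left h3 (by linarith)
        have h7 : ε = 2 * (K * (Real.pi / M)) := by rw [hε]; ring
        have h8 : 0 ≤ K * (Real.pi / M) := by positivity
        linarith
      have h6 := abs_sub_abs_le_abs_sub (dirichletSum l u) (dirichletSum l v)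
      linarith
  have hsum : volume.real (⋃ k ∈ ks, I k) ≤ ks.card * (Real.pi / M) := by
    refine (measureReal_biUnion_finset_le _ _).trans ?_
    rw [Finset.sum_congr rfl (g := fun _ => Real.pi / M)]
    · simp
    · intro k _
      rw [Real.volume_real_Icc_of_le (by nlinarith)]; ring
  have hle := (measureReal_mono (μ := volume) hsub (by
    refine (measure_union_lt_top (volume_ne_top_of_subset_Ioo fun u hu => hu.1).lt_top ?_).ne
    exact (measure_biUnion_lt_top ks.finite_toSet fun _ _ => measure_Icc_lt_top))).trans
    (measureReal_union_le _ _)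
  rw [volume_real_diff_lowSet] at hle
  have hcard' : (ks.card : ℝ) ≤ (unimodularAngles l n).card := by exact_mod_cast hcard
  have h1 : Real.pi - volume.real (lowSet l) - volume.real (bandSet l ε)
      ≤ (unimodularAngles l n).card * (Real.pi / M) := by
    have := mul_le_mul_of_nonneg_right hcard' hδ.le
    linarith
  refine (mul_le_mul_of_nonneg_left h1 hM0.le).trans_eq ?_
  field_simp

/-! ### The limit of the ratios -/

theorem tendsto_card_unimodularAngles_div (l c : ℕ) :
    Tendsto (fun n : ℕ => ((unimodularAngles l n).card : ℝ) / (2 * n + c)) atTop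
      (𝓝 ((Real.pi - volume.real (lowSet l)) / Real.pi)) := by
  obtain ⟨K, hK1, hK, hK2⟩ := exists_dirichletSum_bound l
  have hpi := Real.pi_pos
  have hK0 : 0 < K := by linarith
  have htop : ∀ d : ℕ, Tendsto (fun n : ℕ => (2 * n + d : ℝ)) atTop atTop := fun d =>
    tendsto_atTop_add_const_right _ _ (tendsto_natCast_atTop_atTop.const_mul_atTop two_pos)
  have hMtop : Tendsto (fun n : ℕ => ((2 * n + l : ℕ) : ℝ)) atTop atTop := by
    simpa using htop l
  have hband : Tendsto (fun n : ℕ => volume.real (bandSet l (2 * Real.pi * K / (2 * n + l : ℕ))))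
      atTop (𝓝 0) := by
    refine (tendsto_volume_bandSet l).comp (tendsto_nhdsWithin_iff.2
      ⟨hMtop.const_div_atTop _, ?_⟩)
    filter_upwards [hMtop.eventually_gt_atTop 0] with n hn
    exact div_pos (by positivity) hn
  have hratio : Tendsto (fun n : ℕ => ((2 * n + l : ℕ) : ℝ) / (2 * n + c)) atTop (𝓝 1) := by
    have h := ((htop c).const_div_atTop ((l : ℝ) - c)).const_add 1
    rw [add_zero] at h
    refine h.congr' ?_
    filter_upwards [(htop c).eventually_gt_atTop 0] with n hn
    push_cast
    field_simp
    ring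
  have hconst := (htop c).const_div_atTop (3 * Real.pi)
  have hlow := (hratio.mul ((hband.const_sub (Real.pi - volume.real (lowSet l))))).div_const Real.pi
  have hup := ((hratio.mul ((hband.const_add (Real.pi - volume.real (lowSet l))))).add
    hconst).div_const Real.pi
  simp only [one_mul, sub_zero, add_zero] at hlow hup
  refine tendsto_of_tendsto_of_tendsto_of_le_of_le' hlow hup ?_ ?_
  · filter_upwards [eventually_gt_atTop 0] with n hn
    have h := le_card_unimodularAngles (l := l) hn hK1 hK
    have h0 : (0 : ℝ) < 2 * n + c := by positivity
    rw [div_le_iff₀ hpi, div_mul_eq_mul_div, div_mul_eq_mul_div]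
    refine div_le_div_of_nonneg_right ?_ h0.le
    linarith
  · filter_upwards [eventually_gt_atTop 0, hMtop.eventually_ge_atTop (16 * K)] with n hn hM
    have h := card_unimodularAngles_le (l := l) hn hK1 hK hK2 hM
    have h0 : (0 : ℝ) < 2 * n + c := by positivity
    rw [le_div_iff₀ hpi, div_mul_eq_mul_div, div_mul_eq_mul_div, ← add_div]
    refine div_le_div_of_nonneg_right ?_ h0.le
    linarith

theorem card_nonunimodular_add (l n : ℕ) (hn : 0 < n) :
    ((((polyH l n).aroots ℂ).filter (fun z => ‖z‖ ≠ 1)).card : ℝ)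
      = 2 * n + 2 * l - (unimodularAngles l n).card := by
  have h := congrArg Multiset.card
    (Multiset.filter_add_not (fun z : ℂ => ‖z‖ = 1) ((polyH l n).aroots ℂ))
  rw [Multiset.card_add, IsAlgClosed.card_aroots_eq_natDegree, natDegree_polyH hn] at h
  rw [unimodularAngles, Multiset.card_map, eq_sub_iff_add_eq']
  exact_mod_cast h

theorem tendsto_nonunimodularRatio_polyH (l : ℕ) :
    Tendsto (fun n : ℕ => nonunimodularRatio (polyH l n)) atTop
      (𝓝 (volume.real (lowSet l) / Real.pi)) := by
  have h := (tendsto_card_unimodularAngles_div l (2 * l)).const_sub 1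
  have e : 1 - (Real.pi - volume.real (lowSet l)) / Real.pi = volume.real (lowSet l) / Real.pi := by
    field_simp; ring
  rw [e] at h
  refine h.congr' ?_
  filter_upwards [eventually_gt_atTop 0] with n hn
  have h0 : (0 : ℝ) < 2 * n + 2 * l := by positivity
  rw [nonunimodularRatio, card_nonunimodular_add l n hn, natDegree_polyH hn]
  push_cast
  field_simp

theorem tendsto_nonunimodularRatio_bivP (l : ℕ) :
    Tendsto (fun n : ℕ => nonunimodularRatio (substPow (bivP (l + 1) 1) n)) atTop
      (𝓝 (volume.real (lowSet l) / Real.pi)) := by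
  rw [← tendsto_add_atTop_iff_nat l]
  have h := (tendsto_card_unimodularAngles_div l (3 * l)).const_sub 1
  have e : 1 - (Real.pi - volume.real (lowSet l)) / Real.pi = volume.real (lowSet l) / Real.pi := by
    field_simp; ring
  rw [e] at h
  refine h.congr' ?_
  filter_upwards [eventually_gt_atTop 0] with n hn
  have h0 : (0 : ℝ) < 2 * n + 3 * l := by positivity
  have hX : (X : ℤ[X]) ^ l ≠ 0 := pow_ne_zero _ X_ne_zero
  -- the factor `x ^ l` contributes the zero `0`, of modulus different from `1`, `l` times
  rw [substPow_bivP, nonunimodularRatio, natDegree_mul hX (polyH_ne_zero hn), natDegree_polyH hn,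
    aroots_mul (mul_ne_zero hX (polyH_ne_zero hn)), aroots_X_pow, Multiset.filter_add,
    Multiset.card_add, Nat.cast_add, card_nonunimodular_add l n hn, natDegree_X_pow,
    Multiset.filter_eq_self.2, Multiset.card_nsmul, Multiset.card_singleton]
  · push_cast
    field_simp
    ring
  · intro z hz
    rw [Multiset.mem_singleton.1 (Multiset.mem_of_mem_nsmul hz)]
    simp

theorem bivLimitRatio_bivP_one (l : ℕ) :
    bivLimitRatio (bivP (l + 1) 1) = volume.real (lowSet l) / Real.pi :=
  (tendsto_nonunimodularRatio_bivP l).limUnder_eq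

/-! ### Bounds for the limit ratio -/

theorem mem_lowSet_iff {l : ℕ} {u : ℝ} : u ∈ lowSet l ↔
    u ∈ Ioo 0 Real.pi ∧ |Real.sin ((l + 1 : ℕ) * u)| < 1 / 2 * Real.sin u := by
  refine and_congr_right fun hu => ?_
  have hs : 0 < Real.sin u := Real.sin_pos_of_mem_Ioo hu
  rw [show ((l + 1 : ℕ) : ℝ) * u = (l + 1) * u by push_cast; ring, ← dirichletSum_mul_sin, abs_mul,
    abs_of_pos hs, mul_lt_mul_iff_left₀ hs]

/-- The sum `∑_{k < m} sin (kπ / m)`, equal to `cot (π / 2m)`. -/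
noncomputable def sineSum (m : ℕ) : ℝ :=
  ∑ k ∈ Finset.range m, Real.sin (k * (Real.pi / m))

theorem sineSum_mul_sin {m : ℕ} (hm : 0 < m) :
    sineSum m * Real.sin (Real.pi / 2 / m) = Real.cos (Real.pi / 2 / m) := by
  have hm0 : (m : ℝ) ≠ 0 := by positivity
  set h := Real.pi / 2 / m with hh
  have hk : ∀ k : ℕ, 2 * (Real.sin (k * (Real.pi / m)) * Real.sin h)
      = -Real.cos ((2 * ((k + 1 : ℕ) : ℝ) - 1) * h) - -Real.cos ((2 * (k : ℝ) - 1) * h) := by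
    intro k
    have e1 : (2 * ((k + 1 : ℕ) : ℝ) - 1) * h = k * (Real.pi / m) + h := by
      push_cast; rw [hh]; ring
    have e2 : (2 * (k : ℝ) - 1) * h = k * (Real.pi / m) - h := by rw [hh]; ring
    rw [e1, e2, Real.cos_add, Real.cos_sub]; ring
  have h2 : 2 * (sineSum m * Real.sin h) = 2 * Real.cos h := by
    rw [sineSum, Finset.sum_mul, Finset.mul_sum, Finset.sum_congr rfl fun k _ => hk k,
      Finset.sum_range_sub (fun k : ℕ => -Real.cos ((2 * (k : ℝ) - 1) * h))]
    have e1 : (2 * (m : ℝ) - 1) * h = Real.pi - h := by rw [hh]; field_simp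
    have e2 : (2 * ((0 : ℕ) : ℝ) - 1) * h = -h := by push_cast; ring
    rw [e1, e2, Real.cos_neg, Real.cos_pi_sub]; ring
  linarith

theorem tendsto_sineSum_div : Tendsto (fun m : ℕ => sineSum m / m) atTop (𝓝 (2 / Real.pi)) := by
  have hpi := Real.pi_pos
  have hh : Tendsto (fun m : ℕ => Real.pi / 2 / m) atTop (𝓝 0) :=
    tendsto_natCast_atTop_atTop.const_div_atTop _
  have h1 := (Real.continuous_cos.tendsto 0).comp hh
  have h2 := ((Real.continuous_sinc.tendsto 0).comp hh).const_mul (Real.pi / 2)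
  rw [Real.cos_zero] at h1
  rw [Real.sinc_zero, mul_one] at h2
  have h3 := h1.div h2 (by positivity)
  rw [one_div_div] at h3
  refine h3.congr' ?_
  filter_upwards [eventually_gt_atTop 0] with m hm
  have hm0 : (0 : ℝ) < m := by exact_mod_cast hm
  have hx : 0 < Real.pi / 2 / m := by positivity
  have hs : 0 < Real.sin (Real.pi / 2 / m) := by
    refine Real.sin_pos_of_pos_of_lt_pi hx ((div_le_self (by positivity) ?_).trans_lt (by linarith))
    exact_mod_cast hm
  simp only [Function.comp_apply, Pi.div_apply]
  rw [← sineSum_mul_sin hm, Real.sinc_of_ne_zero hx.ne']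
  obtain ⟨x, hxm⟩ : ∃ x, x = Real.pi / 2 / m := ⟨_, rfl⟩
  have e : Real.pi / 2 = m * x := by rw [hxm]; field_simp
  rw [← hxm] at hx hs ⊢
  rw [e]
  field_simp

theorem abs_sin_mul_eq {m : ℕ} (hm : 0 < m) (k : ℕ) (u : ℝ) :
    |Real.sin (m * u)| = |Real.sin (m * (u - k * (Real.pi / m)))| := by
  have hm0 : (m : ℝ) ≠ 0 := by positivity
  have e : (m : ℝ) * (u - k * (Real.pi / m)) = m * u - k * Real.pi := by field_simp
  rw [e, Real.sin_sub_nat_mul_pi, abs_mul]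
  simp

theorem abs_sin_sub_sin_le (x y : ℝ) : |Real.sin x - Real.sin y| ≤ |x - y| := by
  simpa using Convex.norm_image_sub_le_of_norm_hasDerivWithin_le (s := Set.univ) (C := 1)
    (fun x _ => (Real.hasDerivAt_sin x).hasDerivWithinAt) (fun x _ => Real.abs_cos_le_one x)
    convex_univ (Set.mem_univ y) (Set.mem_univ x)

/-- Around each zero `kπ / m` of `sin (mu)`, the inequality `|sin (mu)| < (sin u) / 2` holds on an
interval of radius about `sin (kπ / m) / 2m`, since `|sin y| ≤ |y|`. -/
theorem sineSum_div_le_volume_lowSet (l : ℕ) :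
    sineSum (l + 1) / ((l + 1 : ℕ) + 1 / 2) ≤ volume.real (lowSet l) := by
  set m : ℕ := l + 1 with hm
  have hpi := Real.pi_pos
  have hpi3 := Real.pi_gt_three
  have hm0 : (0 : ℝ) < m := by positivity
  have hδ : 0 < Real.pi / m := by positivity
  set r : ℕ → ℝ := fun k => 1 / 2 * Real.sin (k * (Real.pi / m)) / (m + 1 / 2) with hr
  set J : ℕ → Set ℝ := fun k => Ioo (k * (Real.pi / m) - r k) (k * (Real.pi / m) + r k)
  have hs0 : ∀ k ∈ Finset.range m, 0 ≤ Real.sin (k * (Real.pi / m)) := by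
    intro k hk
    have hk' : (k : ℝ) ≤ m := by exact_mod_cast (Finset.mem_range.1 hk).le
    refine Real.sin_nonneg_of_nonneg_of_le_pi (by positivity) ?_
    calc k * (Real.pi / m) ≤ m * (Real.pi / m) := mul_le_mul_of_nonneg_right hk' hδ.le
      _ = Real.pi := by field_simp
  have hr0 : ∀ k ∈ Finset.range m, 0 ≤ r k := fun k hk =>
    div_nonneg (mul_nonneg (by norm_num) (hs0 k hk)) (by positivity)
  have hr1 : ∀ k, r k ≤ 1 / 2 * (Real.pi / m) := by
    intro k
    change 1 / 2 * Real.sin (k * (Real.pi / m)) / (m + 1 / 2) ≤ _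
    rw [mul_div_assoc]
    refine mul_le_mul_of_nonneg_left ?_ (by norm_num)
    rw [div_le_div_iff₀ (by positivity) hm0]
    nlinarith [Real.sin_le_one (k * (Real.pi / m))]
  have hdisj : (Finset.range m : Set ℕ).PairwiseDisjoint J := by
    have key : ∀ b c : ℕ, b < c → Disjoint (J b) (J c) := by
      intro b c hbc
      rw [Set.disjoint_left]
      intro v hvb hvc
      have h1 : (b : ℝ) + 1 ≤ c := by exact_mod_cast hbc
      have h2 := mul_le_mul_of_nonneg_right h1 hδ.le
      linarith [hvb.2, hvc.1, hr1 b, hr1 c]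
    intro b _ c _ hbc
    rcases lt_or_gt_of_ne hbc with h | h
    · exact key b c h
    · exact (key c b h).symm
  have hsub : (⋃ k ∈ Finset.range m, J k) ⊆ lowSet l := by
    intro u hu
    simp only [mem_iUnion] at hu
    obtain ⟨k, hk, hu⟩ := hu
    have hw : |u - k * (Real.pi / m)| < r k := by
      rw [abs_lt]; constructor <;> linarith [hu.1, hu.2]
    have hrpos : 0 < r k := (abs_nonneg _).trans_lt hw
    have hk0 : 1 ≤ k := by
      rcases Nat.eq_zero_or_pos k with rfl | h
      · simp [hr] at hrpos
      · exact h
    have hk1 : (1 : ℝ) ≤ k := by exact_mod_cast hk0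
    have hk2 : (k : ℝ) + 1 ≤ m := by exact_mod_cast Finset.mem_range.1 hk
    have h1 := mul_le_mul_of_nonneg_right hk1 hδ.le
    have h2 := mul_le_mul_of_nonneg_right hk2 hδ.le
    have e : (m : ℝ) * (Real.pi / m) = Real.pi := by field_simp
    rw [mem_lowSet_iff]
    refine ⟨⟨by linarith [hu.1, hr1 k], by linarith [hu.2, hr1 k]⟩, ?_⟩
    rw [abs_sin_mul_eq (Nat.succ_pos l) k]
    refine (Real.abs_sin_le_abs).trans_lt ?_
    rw [abs_mul, abs_of_pos hm0]
    have h3 := (abs_le.1 (abs_sin_sub_sin_le u (k * (Real.pi / m)))).1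
    rw [hr, lt_div_iff₀ (by positivity)] at hw
    linarith
  have hvol : volume.real (⋃ k ∈ Finset.range m, J k) = sineSum m / (m + 1 / 2) := by
    rw [measureReal_biUnion_finset hdisj (fun _ _ => measurableSet_Ioo)
      (fun _ _ => measure_Ioo_lt_top.ne), sineSum, Finset.sum_div]
    refine Finset.sum_congr rfl fun k hk => ?_
    rw [Real.volume_real_Ioo_of_le (by linarith [hr0 k hk]), hr]
    ring
  rw [← hvol]
  exact measureReal_mono hsub (volume_ne_top_of_subset_Ioo fun u hu => hu.1)

/-- By concavity of the sine, `sin ((π / 6) s) ≥ s / 2` for `s ∈ [0, 1]`. -/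
theorem abs_lt_of_abs_sin_lt {y s : ℝ} (hy : |y| ≤ Real.pi / 2) (hs0 : 0 ≤ s) (hs1 : s ≤ 1)
    (h : |Real.sin y| < 1 / 2 * s) : |y| < Real.pi / 6 * s := by
  have hpi := Real.pi_pos
  by_contra! hc
  have h1 := strictConcaveOn_sin_Icc.concaveOn.2 (x := Real.pi / 6) (y := 0)
    ⟨by positivity, by linarith⟩ ⟨le_rfl, hpi.le⟩ hs0 (sub_nonneg.2 hs1) (by ring)
  simp only [smul_eq_mul, Real.sin_pi_div_six, Real.sin_zero, mul_zero, add_zero] at h1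
  have h2 : Real.sin (s * (Real.pi / 6)) ≤ Real.sin |y| :=
    Real.sin_le_sin_of_le_of_le_pi_div_two (by nlinarith) hy (by linarith)
  have h3 : Real.sin |y| ≤ |Real.sin y| := by
    rcases abs_cases y with ⟨e, _⟩ | ⟨e, _⟩
    · rw [e]; exact le_abs_self _
    · rw [e, Real.sin_neg]; exact neg_le_abs _
  linarith

/-- The set `|sin (mu)| < (sin u) / 2` is covered by intervals of radius about
`(π / 6) sin (kπ / m) / m` around the zeros `kπ / m` of `sin (mu)`. -/
theorem volume_lowSet_le (l : ℕ) :
    volume.real (lowSet l) ≤ Real.pi / 3 * sineSum (l + 1) / ((l + 1 : ℕ) - Real.pi / 6) := by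
  set m : ℕ := l + 1 with hm
  have hpi := Real.pi_pos
  have hpi4 := Real.pi_lt_four
  have hm1 : (1 : ℝ) ≤ m := by rw [hm]; push_cast; linarith [(l.cast_nonneg : (0 : ℝ) ≤ l)]
  have hm0 : (0 : ℝ) < m := by linarith
  have hδ : 0 < Real.pi / m := by positivity
  have hden : 0 < (m : ℝ) - Real.pi / 6 := by linarith
  have e : (m : ℝ) * (Real.pi / m) = Real.pi := by field_simp
  set r : ℕ → ℝ := fun k => Real.pi / 6 * Real.sin (k * (Real.pi / m)) / (m - Real.pi / 6) with hr
  set J : ℕ → Set ℝ := fun k => Ioo (k * (Real.pi / m) - r k) (k * (Real.pi / m) + r k)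
  have hsub : lowSet l ⊆ ⋃ k ∈ Finset.range (m + 1), J k := by
    intro u hu
    rw [mem_lowSet_iff] at hu
    obtain ⟨hu, hlt⟩ := hu
    have hu0 : 0 ≤ u / (Real.pi / m) + 1 / 2 := by have := div_pos hu.1 hδ; linarith
    have hf1 := Nat.floor_le hu0
    have hf2 := Nat.lt_floor_add_one (u / (Real.pi / m) + 1 / 2)
    set k := ⌊u / (Real.pi / m) + 1 / 2⌋₊
    rw [← sub_le_iff_le_add, le_div_iff₀ hδ] at hf1
    rw [← lt_sub_iff_add_lt, div_lt_iff₀ hδ] at hf2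
    have hw : |m * (u - k * (Real.pi / m))| ≤ Real.pi / 2 := by
      rw [abs_mul, abs_of_pos hm0]
      have : |u - k * (Real.pi / m)| ≤ 1 / 2 * (Real.pi / m) := by
        rw [abs_le]; constructor <;> linarith
      have := mul_le_mul_of_nonneg_left this hm0.le
      linarith
    rw [abs_sin_mul_eq (Nat.succ_pos l) k] at hlt
    have h1 := abs_lt_of_abs_sin_lt hw (Real.sin_pos_of_mem_Ioo hu).le (Real.sin_le_one u) hlt
    rw [abs_mul, abs_of_pos hm0] at h1
    have h2 := (abs_le.1 (abs_sin_sub_sin_le u (k * (Real.pi / m)))).2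
    have h3 : |u - k * (Real.pi / m)| < r k := by
      rw [hr, lt_div_iff₀ hden]
      nlinarith
    rw [abs_lt] at h3
    simp only [mem_iUnion]
    -- the index `k = m` may occur, but its interval is empty as `sin π = 0`
    refine ⟨k, Finset.mem_range.2 ?_, by linarith, by linarith⟩
    have h4 : (k : ℝ) < m + 1 := by
      by_contra! h
      have := mul_le_mul_of_nonneg_right (sub_le_sub_right h (1 / 2)) hδ.le
      linarith [hu.2]
    exact_mod_cast h4
  have hr0 : ∀ k ∈ Finset.range (m + 1), 0 ≤ r k := by
    intro k hk
    have hk' : (k : ℝ) ≤ m := by exact_mod_cast Nat.lt_succ_iff.1 (Finset.mem_range.1 hk)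
    refine div_nonneg (mul_nonneg (by positivity)
      (Real.sin_nonneg_of_nonneg_of_le_pi (by positivity) ?_)) hden.le
    linarith [mul_le_mul_of_nonneg_right hk' hδ.le]
  have hsum : ∑ k ∈ Finset.range (m + 1), volume.real (J k)
      = Real.pi / 3 * sineSum m / (m - Real.pi / 6) := by
    have h1 : ∀ k ∈ Finset.range (m + 1), volume.real (J k)
        = Real.pi / 3 / (m - Real.pi / 6) * Real.sin (k * (Real.pi / m)) := by
      intro k hk
      rw [Real.volume_real_Ioo_of_le (by linarith [hr0 k hk]), hr]
      ring
    rw [Finset.sum_congr rfl h1, ← Finset.mul_sum, Finset.sum_range_succ, e, Real.sin_pi, add_zero,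
      sineSum]
    ring
  rw [← hsum]
  refine (measureReal_mono hsub ?_).trans (measureReal_biUnion_finset_le _ _)
  exact (measure_biUnion_lt_top (Finset.range (m + 1)).finite_toSet
    fun _ _ => measure_Ioo_lt_top).ne

theorem tendsto_sineSum_div_add (c : ℝ) :
    Tendsto (fun m : ℕ => sineSum m / (m + c)) atTop (𝓝 (2 / Real.pi)) := by
  have htop : Tendsto (fun m : ℕ => (m : ℝ) + c) atTop atTop :=
    tendsto_atTop_add_const_right _ _ tendsto_natCast_atTop_atTop
  have h1 := tendsto_sineSum_div.mul ((htop.const_div_atTop c).const_sub 1)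
  rw [sub_zero, mul_one] at h1
  refine h1.congr' ?_
  filter_upwards [htop.eventually_gt_atTop 0, eventually_gt_atTop 0] with m hm hm0
  have hm0' : (m : ℝ) ≠ 0 := by positivity
  field_simp
  ring

end Measure

/-! ### The limits and their accumulation points -/

theorem mainTheorem4 :
    (∀ m : ℕ, 1 < m →
      Tendsto (fun n : ℕ => nonunimodularRatio (substPow (bivP m 1) n)) atTop
        (𝓝 (bivLimitRatio (bivP m 1))) ∧
      Tendsto (fun n : ℕ => nonunimodularRatio (polyH (m - 1) n)) atTop
        (𝓝 (bivLimitRatio (bivP m 1)))) ∧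
    ∀ A : ℝ, MapClusterPt A atTop (fun m : ℕ => bivLimitRatio (bivP m 1)) →
      2 / Real.pi ^ 2 ≤ A ∧ A ≤ 2 / (3 * Real.pi) := by
  have hpi := Real.pi_pos
  refine ⟨fun m hm => ?_, fun A hA => ⟨?_, ?_⟩⟩
  · obtain ⟨l, rfl⟩ : ∃ l, m = l + 1 := ⟨m - 1, by omega⟩
    rw [bivLimitRatio_bivP_one, Nat.add_sub_cancel]
    exact ⟨tendsto_nonunimodularRatio_bivP l, tendsto_nonunimodularRatio_polyH l⟩
  · have hlim := (tendsto_sineSum_div_add (1 / 2)).div_const Real.pi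
    rw [div_div, ← sq] at hlim
    by_contra! hlt
    obtain ⟨c, hAc, hc⟩ := exists_between hlt
    have hev : ∀ᶠ m : ℕ in atTop, c < bivLimitRatio (bivP m 1) := by
      filter_upwards [hlim.eventually_const_lt hc, eventually_gt_atTop 0] with m hm hm0
      obtain ⟨l, rfl⟩ : ∃ l, m = l + 1 := ⟨m - 1, by omega⟩
      rw [bivLimitRatio_bivP_one]
      exact hm.trans_le (div_le_div_of_nonneg_right (sineSum_div_le_volume_lowSet l) hpi.le)
    obtain ⟨m, h1, h2⟩ := ((hA.frequently (eventually_lt_nhds hAc)).and_eventually hev).exists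
    exact lt_asymm h1 h2
  · have hlim := ((tendsto_sineSum_div_add (-(Real.pi / 6))).const_mul (Real.pi / 3)).div_const
      Real.pi
    rw [show Real.pi / 3 * (2 / Real.pi) / Real.pi = 2 / (3 * Real.pi) by field_simp] at hlim
    by_contra! hlt
    obtain ⟨c, hc, hcA⟩ := exists_between hlt
    have hev : ∀ᶠ m : ℕ in atTop, bivLimitRatio (bivP m 1) < c := by
      filter_upwards [hlim.eventually_lt_const hc, eventually_gt_atTop 0] with m hm hm0
      obtain ⟨l, rfl⟩ : ∃ l, m = l + 1 := ⟨m - 1, by omega⟩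
      rw [bivLimitRatio_bivP_one]
      rw [← sub_eq_add_neg, ← mul_div_assoc] at hm
      exact (div_le_div_of_nonneg_right (volume_lowSet_le l) hpi.le).trans_lt hm
    obtain ⟨m, h1, h2⟩ := ((hA.frequently (eventually_gt_nhds hcA)).and_eventually hev).exists
    exact lt_asymm h1 h2
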